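/- Notation: for a random vector $X$ in $\mathbb{R}^n$ ($n\ge 1$) with density $f$ with respect to Lebesgue measure, its entropy is $h(X) = -\int_{\mathbb{R}^n} f(x)\log f(x)\,dx$, provided that the integral exists in the Lebesgue sense, and its entropy power is $H(X) = e^{2h(X)/n}$. A convex body in $\mathbb{R}^n$ is a compact convex set with nonempty interior, $|A|$ denotes the $n$-dimensional volume of $A$, and sums of sets are Minkowski sums. Proposition 3.4. Let $m \ge 1$, and let $X_1,\dots,X_m$ be independent random vectors, with $X_i$ uniformly distributed in a convex body $A_i\subset\mathbb{R}^n$ for each $i$. Then their sum $S_m = X_1+\dots+X_m$ has a density, its entropy exists and is finite, and $$\log|A_1+\dots+A_m| - n\log m \;\le\; h(S_m) \;\le\; \log|A_1+\dots+A_m|.$$ In particular, if $X$ and $Y$ are independent and uniformly distributed in convex bodies $A$ and $B$ in $\mathbb{R}^n$, respectively, then $X+Y$ has a density and finite entropy, and $$\tfrac14\,|A+B|^{2/n} \;\le\; H(X+Y) \;\le\; |A+B|^{2/n}.$$ -/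

import Mathlib

open MeasureTheory ProbabilityTheory
open scoped Pointwise ENNReal

noncomputable section

namespace VolEnt

/-- The density `f` of a random vector `X` in `ℝⁿ` with respect to Lebesgue measure
(meaningful when the law of `X` is absolutely continuous). -/
def density {Ω : Type*} [MeasurableSpace Ω] {n : ℕ}
    (X : Ω → EuclideanSpace ℝ (Fin n)) (P : Measure Ω) (x : EuclideanSpace ℝ (Fin n)) : ℝ :=
  (pdf X P volume x).toReal

/-- `X` has a density `f`, and `f log f` is Lebesgue integrable, i.e. the entropy of `X` exists
and is finite. -/
def HasEntropy {Ω : Type*} [MeasurableSpace Ω] {n : ℕ}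
    (X : Ω → EuclideanSpace ℝ (Fin n)) (P : Measure Ω) : Prop :=
  HasPDF X P volume ∧
    Integrable (fun x => density X P x * Real.log (density X P x)) volume

/-- The differential entropy `h(X) = - ∫ f(x) log f(x) dx`. -/
def entropy {Ω : Type*} [MeasurableSpace Ω] {n : ℕ}
    (X : Ω → EuclideanSpace ℝ (Fin n)) (P : Measure Ω) : ℝ :=
  - ∫ x, density X P x * Real.log (density X P x)

/-- The entropy power `H(X) = exp (2 h(X) / n)`. -/
def entropyPower {Ω : Type*} [MeasurableSpace Ω] {n : ℕ}
    (X : Ω → EuclideanSpace ℝ (Fin n)) (P : Measure Ω) : ℝ :=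
  Real.exp (2 * entropy X P / n)

/-- A convex body in `ℝⁿ`: a compact convex set with nonempty interior. -/
structure IsConvexBody {n : ℕ} (A : Set (EuclideanSpace ℝ (Fin n))) : Prop where
  convex : Convex ℝ A
  isCompact : IsCompact A
  interior_nonempty : (interior A).Nonempty

end VolEnt

end

namespace VolEnt

/-- The Prékopa–Leindler inequality for the measure `μ`. -/
def PrekopaLeindler {E : Type*} [MeasurableSpace E] [AddCommGroup E] [Module ℝ E]
    (μ : Measure E) : Prop :=
  ∀ t : ℝ, 0 < t → t < 1 → ∀ u v h : E → ℝ≥0∞, Measurable u → Measurable v → Measurable h →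
    (∀ x y, u x ^ (1 - t) * v y ^ t ≤ h ((1 - t) • x + t • y)) →
    (∫⁻ x, u x ∂μ) ^ (1 - t) * (∫⁻ x, v x ∂μ) ^ t ≤ ∫⁻ x, h x ∂μ

/-- The one-dimensional Brunn–Minkowski inequality for compact sets. -/
theorem volume_add_le_of_isCompact {A B C : Set ℝ} (hA : IsCompact A) (hB : IsCompact B)
    (hAn : A.Nonempty) (hBn : B.Nonempty) (h : ∀ a ∈ A, ∀ b ∈ B, a + b ∈ C) :
    volume A + volume B ≤ volume C := by
  obtain ⟨M, hM, hMmax⟩ := hA.exists_isGreatest hAn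
  obtain ⟨m, hm, hmmin⟩ := hB.exists_isLeast hBn
  have h1 : volume ((fun x => m + x) '' A) = volume A := by
    rw [Set.image_add_left]; exact measure_preimage_add _ _ _
  have h2 : volume ((fun x => M + x) '' B) = volume B := by
    rw [Set.image_add_left]; exact measure_preimage_add _ _ _
  have hd : AEDisjoint volume ((fun x => m + x) '' A) ((fun x => M + x) '' B) := by
    refine measure_mono_null (t := {M + m}) ?_ (by simp)
    rintro z ⟨⟨a, ha, rfl⟩, b, hb, hab⟩
    have := hMmax ha
    have := hmmin hb
    simp only [Set.mem_singleton_iff] at *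
    linarith
  rw [← h1, ← h2, ← measure_union₀ _ hd]
  · refine measure_mono (Set.union_subset ?_ ?_)
    · rintro _ ⟨a, ha, rfl⟩
      simpa [add_comm] using h a ha m hm
    · rintro _ ⟨b, hb, rfl⟩
      exact h M hM b hb
  · exact (hB.image (by fun_prop)).measurableSet.nullMeasurableSet

/-- The one-dimensional Brunn–Minkowski inequality. -/
theorem volume_add_le {A B C : Set ℝ} (hA : MeasurableSet A) (hB : MeasurableSet B)
    (hAn : A.Nonempty) (hBn : B.Nonempty) (h : ∀ a ∈ A, ∀ b ∈ B, a + b ∈ C) :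
    volume A + volume B ≤ volume C := by
  obtain ⟨a, ha⟩ := hAn
  obtain ⟨b, hb⟩ := hBn
  rw [hA.measure_eq_iSup_isCompact, hB.measure_eq_iSup_isCompact]
  simp only [iSup_and']
  refine ENNReal.biSup_add_biSup_le' ⟨∅, by simp⟩ ⟨∅, by simp⟩ fun K hK L hL => ?_
  refine le_trans (add_le_add (measure_mono (Set.subset_insert a K))
    (measure_mono (Set.subset_insert b L))) ?_
  refine volume_add_le_of_isCompact (hK.2.insert a) (hL.2.insert b) (by simp) (by simp) ?_
  intro x hx y hy
  exact h x (Set.insert_subset ha hK.1 hx) y (Set.insert_subset hb hL.1 hy)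

theorem weighted_volume_add_le {A B C : Set ℝ} (hA : MeasurableSet A) (hB : MeasurableSet B)
    (hAn : A.Nonempty) (hBn : B.Nonempty) {t : ℝ} (ht0 : 0 < t) (ht1 : t < 1)
    (h : ∀ a ∈ A, ∀ b ∈ B, (1 - t) * a + t * b ∈ C) :
    ENNReal.ofReal (1 - t) * volume A + ENNReal.ofReal t * volume B ≤ volume C := by
  have e1 : volume ((1 - t) • A) = ENNReal.ofReal (1 - t) * volume A := by
    rw [Measure.addHaar_smul_of_nonneg _ (by linarith)]; simp
  have e2 : volume (t • B) = ENNReal.ofReal t * volume B := by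
    rw [Measure.addHaar_smul_of_nonneg _ ht0.le]; simp
  rw [← e1, ← e2]
  refine volume_add_le (hA.const_smul₀ _) (hB.const_smul₀ _) hAn.smul_set hBn.smul_set ?_
  rintro _ ⟨a, ha, rfl⟩ _ ⟨b, hb, rfl⟩
  exact h a ha b hb

theorem lintegral_eq_lintegral_meas_ofReal_lt {α : Type*} [MeasurableSpace α] (μ : Measure α)
    {u : α → ℝ≥0∞} (hu : Measurable u) (hf : ∀ x, u x ≠ ∞) :
    ∫⁻ x, u x ∂μ = ∫⁻ s in Set.Ioi (0 : ℝ), μ {x | ENNReal.ofReal s < u x} := by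
  have := lintegral_eq_lintegral_meas_lt μ (f := fun x => (u x).toReal)
    (Filter.Eventually.of_forall fun x => ENNReal.toReal_nonneg) hu.ennreal_toReal.aemeasurable
  simp only [ENNReal.ofReal_toReal (hf _)] at this
  rw [this]
  refine setLIntegral_congr_fun measurableSet_Ioi fun s hs => ?_
  simp only [ENNReal.ofReal_lt_iff_lt_toReal (le_of_lt hs) (hf _)]

/-- The weighted inequality between the geometric and arithmetic means of two extended nonnegative
numbers. -/
theorem geom_mean_le_arith_mean_ennreal {t : ℝ} (ht0 : 0 < t) (ht1 : t < 1) (a b : ℝ≥0∞) :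
    a ^ (1 - t) * b ^ t ≤ ENNReal.ofReal (1 - t) * a + ENNReal.ofReal t * b := by
  have ht1' : 0 < 1 - t := by linarith
  have hpq : (1 - t)⁻¹.HolderConjugate t⁻¹ :=
    Real.holderConjugate_iff.2 ⟨(one_lt_inv₀ ht1').2 (by linarith), by simp⟩
  have := ENNReal.young_inequality (a ^ (1 - t)) (b ^ t) hpq
  rwa [← ENNReal.rpow_mul, ← ENNReal.rpow_mul, mul_inv_cancel₀ ht1'.ne', mul_inv_cancel₀ ht0.ne',
    ENNReal.rpow_one, ENNReal.rpow_one, ENNReal.ofReal_inv_of_pos ht1',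
    ENNReal.ofReal_inv_of_pos ht0, div_eq_mul_inv, div_eq_mul_inv, inv_inv, inv_inv,
    mul_comm a, mul_comm b] at this

/-- Prékopa–Leindler on the line, for functions with supremum one. -/
theorem prekopaLeindler_real_of_iSup_eq_one {t : ℝ} (ht0 : 0 < t) (ht1 : t < 1)
    {u v h : ℝ → ℝ≥0∞} (hu : Measurable u) (hv : Measurable v) (hh : Measurable h)
    (hu1 : ⨆ x, u x = 1) (hv1 : ⨆ x, v x = 1)
    (H : ∀ x y, u x ^ (1 - t) * v y ^ t ≤ h ((1 - t) * x + t * y)) :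
    (∫⁻ x, u x) ^ (1 - t) * (∫⁻ x, v x) ^ t ≤ ∫⁻ x, h x := by
  have ht1' : 0 < 1 - t := by linarith
  have hu_le : ∀ x, u x ≤ 1 := fun x => hu1 ▸ le_iSup u x
  have hv_le : ∀ x, v x ≤ 1 := fun x => hv1 ▸ le_iSup v x
  have key : ∀ s ∈ Set.Ioi (0 : ℝ), ENNReal.ofReal (1 - t) * volume {x | ENNReal.ofReal s < u x}
      + ENNReal.ofReal t * volume {x | ENNReal.ofReal s < v x}
      ≤ volume {x | ENNReal.ofReal s < min (h x) 1} := by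
    intro s hs
    rcases lt_or_ge s 1 with hs1 | hs1
    · have hs1' : ENNReal.ofReal s < 1 := by simpa using hs1
      refine weighted_volume_add_le (measurableSet_lt measurable_const hu)
        (measurableSet_lt measurable_const hv) ?_ ?_ ht0 ht1 ?_
      · exact lt_iSup_iff.1 (hu1.symm ▸ hs1')
      · exact lt_iSup_iff.1 (hv1.symm ▸ hs1')
      · intro a ha b hb
        refine lt_min (lt_of_lt_of_le ?_ (H a b)) hs1'
        have hs0 : ENNReal.ofReal s ≠ 0 := by simpa using hs
        calc ENNReal.ofReal s = ENNReal.ofReal s ^ (1 - t) * ENNReal.ofReal s ^ t := by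
              rw [← ENNReal.rpow_add _ _ hs0 ENNReal.ofReal_ne_top]; simp
          _ < u a ^ (1 - t) * v b ^ t :=
              ENNReal.mul_lt_mul (ENNReal.rpow_lt_rpow ha ht1') (ENNReal.rpow_lt_rpow hb ht0)
    · have hs1' : 1 ≤ ENNReal.ofReal s := by simpa using hs1
      have e1 : {x | ENNReal.ofReal s < u x} = ∅ := by
        ext x; simpa using (hu_le x).trans hs1'
      have e2 : {x | ENNReal.ofReal s < v x} = ∅ := by
        ext x; simpa using (hv_le x).trans hs1'
      simp [e1, e2]
  have hne : ∀ {w : ℝ → ℝ≥0∞}, (∀ x, w x ≤ 1) → ∀ x, w x ≠ ∞ :=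
    fun hw x => ((hw x).trans_lt ENNReal.one_lt_top).ne
  calc (∫⁻ x, u x) ^ (1 - t) * (∫⁻ x, v x) ^ t
      ≤ ENNReal.ofReal (1 - t) * (∫⁻ x, u x) + ENNReal.ofReal t * (∫⁻ x, v x) := by
        exact geom_mean_le_arith_mean_ennreal ht0 ht1 _ _
    _ ≤ ∫⁻ x, min (h x) 1 := by
        rw [lintegral_eq_lintegral_meas_ofReal_lt _ hu (hne hu_le),
          lintegral_eq_lintegral_meas_ofReal_lt _ hv (hne hv_le),
          lintegral_eq_lintegral_meas_ofReal_lt _ (hh.min measurable_const)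
            (hne fun x => min_le_right _ _),
          ← lintegral_const_mul' _ _ ENNReal.ofReal_ne_top,
          ← lintegral_const_mul' _ _ ENNReal.ofReal_ne_top]
        exact (le_lintegral_add _ _).trans (setLIntegral_mono' measurableSet_Ioi key)
    _ ≤ ∫⁻ x, h x := lintegral_mono fun x => min_le_left _ _

/-- Prékopa–Leindler on the line, for bounded functions. -/
theorem prekopaLeindler_real_of_bounded {t : ℝ} (ht0 : 0 < t) (ht1 : t < 1)
    {u v h : ℝ → ℝ≥0∞} (hu : Measurable u) (hv : Measurable v) (hh : Measurable h)
    (hut : ⨆ x, u x ≠ ∞) (hvt : ⨆ x, v x ≠ ∞)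
    (H : ∀ x y, u x ^ (1 - t) * v y ^ t ≤ h ((1 - t) * x + t * y)) :
    (∫⁻ x, u x) ^ (1 - t) * (∫⁻ x, v x) ^ t ≤ ∫⁻ x, h x := by
  have ht1' : 0 < 1 - t := by linarith
  set a := ⨆ x, u x with ha
  set b := ⨆ x, v x with hb
  rcases eq_or_ne a 0 with ha0 | ha0
  · have : ∀ x, u x = 0 := by simpa [ha] using ha0
    simp [this, ENNReal.zero_rpow_of_pos ht1']
  rcases eq_or_ne b 0 with hb0 | hb0
  · have : ∀ x, v x = 0 := by simpa [hb] using hb0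
    simp [this, ENNReal.zero_rpow_of_pos ht0]
  set c := a ^ (1 - t) * b ^ t with hc
  have ha' : a ^ (1 - t) ≠ 0 := by simp [ENNReal.rpow_eq_zero_iff, ha0, hut]
  have hb' : b ^ t ≠ 0 := by simp [ENNReal.rpow_eq_zero_iff, hb0, hvt]
  have hat : a ^ (1 - t) ≠ ∞ := ENNReal.rpow_ne_top_of_nonneg ht1'.le hut
  have hbt : b ^ t ≠ ∞ := ENNReal.rpow_ne_top_of_nonneg ht0.le hvt
  have hc0 : c ≠ 0 := mul_ne_zero ha' hb'
  have hct : c ≠ ∞ := ENNReal.mul_ne_top hat hbt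
  have key := prekopaLeindler_real_of_iSup_eq_one ht0 ht1 (hu.const_mul a⁻¹) (hv.const_mul b⁻¹)
    (hh.const_mul c⁻¹) (by rw [← ENNReal.mul_iSup, ENNReal.inv_mul_cancel ha0 hut])
    (by rw [← ENNReal.mul_iSup, ENNReal.inv_mul_cancel hb0 hvt]) (fun x y => by
      rw [ENNReal.mul_rpow_of_nonneg _ _ ht1'.le, ENNReal.mul_rpow_of_nonneg _ _ ht0.le,
        ENNReal.inv_rpow, ENNReal.inv_rpow, mul_mul_mul_comm,
        ← ENNReal.mul_inv (Or.inl ha') (Or.inl hat)]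
      gcongr
      exact H x y)
  rw [lintegral_const_mul _ hu, lintegral_const_mul _ hv, lintegral_const_mul _ hh,
    ENNReal.mul_rpow_of_nonneg _ _ ht1'.le, ENNReal.mul_rpow_of_nonneg _ _ ht0.le,
    ENNReal.inv_rpow, ENNReal.inv_rpow, mul_mul_mul_comm,
    ← ENNReal.mul_inv (Or.inl ha') (Or.inl hat)] at key
  rwa [ENNReal.mul_le_mul_iff_right (ENNReal.inv_ne_zero.2 hct) (ENNReal.inv_ne_top.2 hc0)] at key

theorem iSup_lintegral_min_natCast {α : Type*} [MeasurableSpace α] (μ : Measure α)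
    {u : α → ℝ≥0∞} (hu : Measurable u) :
    ∫⁻ x, u x ∂μ = ⨆ N : ℕ, ∫⁻ x, min (u x) N ∂μ := by
  rw [← lintegral_iSup]
  · refine lintegral_congr fun x => ?_
    have : ⨆ N : ℕ, min (u x) (N : ℝ≥0∞) = min (u x) (⨆ N : ℕ, (N : ℝ≥0∞)) :=
      (inf_iSup_eq _ _).symm
    rw [this, ENNReal.iSup_natCast]; simp
  · exact fun N => hu.min measurable_const
  · intro i j hij x
    exact min_le_min le_rfl (by exact_mod_cast hij)

theorem iSup_rpow {ι : Sort*} (f : ι → ℝ≥0∞) {p : ℝ} (hp : 0 < p) :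
    (⨆ i, f i) ^ p = ⨆ i, f i ^ p :=
  (ENNReal.orderIsoRpow p hp).map_iSup f

theorem prekopaLeindler_real : PrekopaLeindler (volume : Measure ℝ) := by
  intro t ht0 ht1 u v h hu hv hh H
  rw [iSup_lintegral_min_natCast _ hu, iSup_lintegral_min_natCast _ hv,
    iSup_rpow _ (by linarith), iSup_rpow _ ht0, ENNReal.iSup_mul]
  refine iSup_le fun N => ?_
  rw [ENNReal.mul_iSup]
  refine iSup_le fun M => ?_
  have hb : ∀ (w : ℝ → ℝ≥0∞) (N : ℕ), ⨆ x, min (w x) (N : ℝ≥0∞) ≠ ∞ := fun w N =>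
    ((iSup_le fun x => min_le_right _ _).trans_lt (ENNReal.natCast_lt_top N)).ne
  refine prekopaLeindler_real_of_bounded ht0 ht1 (hu.min measurable_const)
    (hv.min measurable_const) hh (hb u N) (hb v M) fun x y => le_trans ?_ (H x y)
  have : 0 ≤ 1 - t := by linarith
  gcongr
  · exact min_le_left _ _
  · exact min_le_left _ _

section

variable {E F : Type*} [MeasurableSpace E] [AddCommGroup E] [Module ℝ E]
  [MeasurableSpace F] [AddCommGroup F] [Module ℝ F]

theorem PrekopaLeindler.prod {μ : Measure E} {ν : Measure F} [SFinite μ] [SFinite ν]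
    (hμ : PrekopaLeindler μ) (hν : PrekopaLeindler ν) : PrekopaLeindler (μ.prod ν) := by
  intro t ht0 ht1 u v h hu hv hh H
  rw [lintegral_prod _ hu.aemeasurable, lintegral_prod _ hv.aemeasurable,
    lintegral_prod _ hh.aemeasurable]
  refine hμ t ht0 ht1 _ _ _ hu.lintegral_prod_right' hv.lintegral_prod_right'
    hh.lintegral_prod_right' fun x x' => ?_
  exact hν t ht0 ht1 (fun y => u (x, y)) (fun y => v (x', y)) _ (by fun_prop) (by fun_prop)
    (by fun_prop) fun y y' => H (x, y) (x', y')

theorem PrekopaLeindler.of_measurePreserving {μ : Measure E} {ν : Measure F}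
    (hμ : PrekopaLeindler μ) {e : E → F} (he : MeasurePreserving e μ ν)
    (hlin : ∀ (a b : ℝ) x y, e (a • x + b • y) = a • e x + b • e y) : PrekopaLeindler ν := by
  intro t ht0 ht1 u v h hu hv hh H
  rw [← he.lintegral_comp hu, ← he.lintegral_comp hv, ← he.lintegral_comp hh]
  refine hμ t ht0 ht1 _ _ _ (hu.comp he.measurable) (hv.comp he.measurable)
    (hh.comp he.measurable) fun x y => ?_
  rw [hlin]
  exact H _ _

end

theorem prekopaLeindler_pi (n : ℕ) : PrekopaLeindler (volume : Measure (Fin n → ℝ)) := by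
  induction n with
  | zero =>
    intro t ht0 ht1 u v h hu hv hh H
    have hc : ∀ w : (Fin 0 → ℝ) → ℝ≥0∞, ∫⁻ x, w x = w 0 := fun w => by
      rw [lintegral_congr fun x => congrArg w (Subsingleton.elim x 0)]
      simp [volume_pi]
    rw [hc, hc, hc]
    simpa using H 0 0
  | succ n ih =>
    refine (prekopaLeindler_real.prod ih).of_measurePreserving
      (volume_preserving_piFinSuccAbove (fun _ => ℝ) 0).symm fun a b x y => ?_
    ext i
    refine Fin.cases ?_ (fun j => ?_) i <;>
      simp [MeasurableEquiv.piFinSuccAbove]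

theorem prekopaLeindler_euclideanSpace (n : ℕ) :
    PrekopaLeindler (volume : Measure (EuclideanSpace ℝ (Fin n))) :=
  (prekopaLeindler_pi n).of_measurePreserving (PiLp.volume_preserving_toLp (Fin n))
    fun _ _ _ _ => rfl

/-- `μ` has a bounded density, vanishing off `K`, which loses at most a factor `(1 - ε) ^ d` when
a point is moved to the fraction `ε` of its way to a point of `K`. -/
def HasTameDensity {n : ℕ} (μ : Measure (EuclideanSpace ℝ (Fin n)))
    (K : Set (EuclideanSpace ℝ (Fin n))) (d : ℕ) : Prop :=
  ∃ f : EuclideanSpace ℝ (Fin n) → ℝ≥0∞, Measurable f ∧ μ = volume.withDensity f ∧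
    (∃ C, C ≠ ∞ ∧ ∀ x, f x ≤ C) ∧ (∀ x, x ∉ K → f x = 0) ∧
    ∀ ε : ℝ, 0 < ε → ε < 1 → ∀ x, ∀ y ∈ K,
      ENNReal.ofReal (1 - ε) ^ d * f x ≤ f ((1 - ε) • x + ε • y)

section

variable {n : ℕ}

theorem lintegral_comp_smul_add (φ : EuclideanSpace ℝ (Fin n) → ℝ≥0∞) (hφ : Measurable φ)
    {r : ℝ} (hr : 0 < r) (b : EuclideanSpace ℝ (Fin n)) :
    ∫⁻ x, φ (r • x + b) = ENNReal.ofReal (r ^ n)⁻¹ * ∫⁻ x, φ x := by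
  have h1 : ∫⁻ x, φ (r • x + b) = ∫⁻ x, φ (x + b)
      ∂(Measure.map (r • ·) (volume : Measure (EuclideanSpace ℝ (Fin n)))) := by
    rw [lintegral_map (by fun_prop) (by fun_prop)]
  rw [h1, Measure.map_addHaar_smul _ hr.ne', lintegral_smul_measure, lintegral_add_right_eq_self,
    finrank_euclideanSpace_fin, abs_of_pos (by positivity), smul_eq_mul]

theorem IsConvexBody.volume_ne_zero {A : Set (EuclideanSpace ℝ (Fin n))} (hA : IsConvexBody A) :
    volume A ≠ 0 :=
  (Measure.measure_pos_of_nonempty_interior _ hA.interior_nonempty).ne'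

theorem IsConvexBody.volume_ne_top {A : Set (EuclideanSpace ℝ (Fin n))} (hA : IsConvexBody A) :
    volume A ≠ ∞ :=
  hA.isCompact.measure_lt_top.ne

theorem IsConvexBody.add {A B : Set (EuclideanSpace ℝ (Fin n))} (hA : IsConvexBody A)
    (hB : IsConvexBody B) : IsConvexBody (A + B) where
  convex := hA.convex.add hB.convex
  isCompact := hA.isCompact.add hB.isCompact
  interior_nonempty := by
    obtain ⟨a, ha⟩ := hA.interior_nonempty
    obtain ⟨b, hb⟩ := hB.interior_nonempty
    exact ⟨a + b, subset_interior_add_left (Set.add_mem_add ha (interior_subset hb))⟩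

theorem cond_eq_withDensity {A : Set (EuclideanSpace ℝ (Fin n))} (hA : IsConvexBody A) :
    cond volume A = volume.withDensity (A.indicator fun _ => (volume A)⁻¹) := by
  rw [withDensity_indicator hA.isCompact.measurableSet, withDensity_const]
  rfl

theorem HasTameDensity.cond {A : Set (EuclideanSpace ℝ (Fin n))} (hA : IsConvexBody A) :
    HasTameDensity (cond volume A) A 0 := by
  refine ⟨A.indicator fun _ => (volume A)⁻¹,
    measurable_const.indicator hA.isCompact.measurableSet, cond_eq_withDensity hA,
    ⟨(volume A)⁻¹, ENNReal.inv_ne_top.2 hA.volume_ne_zero, fun x => ?_⟩, fun x hx => by simp [hx],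
    fun ε hε0 hε1 x y hy => ?_⟩
  · by_cases hx : x ∈ A <;> simp [hx]
  · by_cases hx : x ∈ A
    · have := hA.convex hx hy (by linarith : 0 ≤ 1 - ε) hε0.le (by ring)
      simp [hx, this]
    · simp [hx]

theorem HasTameDensity.cond_conv {A K : Set (EuclideanSpace ℝ (Fin n))} (hA : IsConvexBody A)
    {μ : Measure (EuclideanSpace ℝ (Fin n))} {d : ℕ} (hμ : HasTameDensity μ K d) :
    HasTameDensity (ProbabilityTheory.cond volume A ∗ μ) (A + K) (d + n) := by
  obtain ⟨f, hf, rfl, ⟨C, hC, hfC⟩, hf0, hfg⟩ := hμ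
  set g : EuclideanSpace ℝ (Fin n) → ℝ≥0∞ := A.indicator fun _ => (volume A)⁻¹ with hg_def
  have hg : Measurable g := measurable_const.indicator hA.isCompact.measurableSet
  have hg1 : ∫⁻ x, g x = 1 := by
    rw [lintegral_indicator hA.isCompact.measurableSet, setLIntegral_const,
      ENNReal.inv_mul_cancel hA.volume_ne_zero hA.volume_ne_top]
  refine ⟨g ⋆ₗ f, by fun_prop, by rw [cond_eq_withDensity hA, conv_withDensity_eq_lconvolution hg hf],
    ⟨C, hC, fun x => ?_⟩, fun x hx => ?_, ?_⟩
  · calc (g ⋆ₗ f) x ≤ ∫⁻ y, g y * C := lintegral_mono fun y => by gcongr; exact hfC _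
      _ = C := by rw [lintegral_mul_const _ hg, hg1, one_mul]
  · have : ∀ y, g y * f (-y + x) = 0 := fun y => by
      by_cases hy : y ∈ A
      · rw [hf0 _ fun h => hx ⟨y, hy, _, h, by simp⟩, mul_zero]
      · simp [hg_def, hy]
    simp [lconvolution_def, this]
  · rintro ε hε0 hε1 x _ ⟨b, hb, y, hy, rfl⟩
    have hε : 0 < 1 - ε := by linarith
    set z := (1 - ε) • x + ε • (b + y) with hz
    have hcv := lintegral_comp_smul_add (fun w => g w * f (-w + z)) (by fun_prop) hε (ε • b)
    have hpow : ENNReal.ofReal ((1 - ε) ^ n) * ENNReal.ofReal ((1 - ε) ^ n)⁻¹ = 1 := by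
      rw [← ENNReal.ofReal_mul (by positivity), mul_inv_cancel₀ (by positivity),
        ENNReal.ofReal_one]
    have hcv' : (g ⋆ₗ f) z = ENNReal.ofReal (1 - ε) ^ n *
        ∫⁻ a, g ((1 - ε) • a + ε • b) * f (-((1 - ε) • a + ε • b) + z) := by
      rw [hcv, ← mul_assoc, ← ENNReal.ofReal_pow hε.le, hpow, one_mul, lconvolution_def]
    rw [hcv', pow_add, mul_comm (_ ^ d), mul_assoc, lconvolution_def,
      ← lintegral_const_mul _ (by fun_prop)]
    refine mul_le_mul_right (lintegral_mono fun a => ?_) _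
    dsimp only
    by_cases ha : a ∈ A
    · have hmem := hA.convex ha hb hε.le hε0.le (by ring)
      have e : -((1 - ε) • a + ε • b) + z = (1 - ε) • (-a + x) + ε • y := by
        rw [hz]; module
      have hga : g ((1 - ε) • a + ε • b) = g a := by simp only [hg_def, Set.indicator, ha, hmem]
      rw [e, hga, mul_left_comm]
      gcongr
      exact hfg ε hε0 hε1 _ y hy
    · simp [hg_def, ha]

end

section

variable {Ω : Type*} [MeasurableSpace Ω] {P : Measure Ω} [IsProbabilityMeasure P] {n : ℕ}

theorem HasTameDensity.map_add {A K : Set (EuclideanSpace ℝ (Fin n))} (hA : IsConvexBody A)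
    {X Y : Ω → EuclideanSpace ℝ (Fin n)} {d : ℕ} (hX : pdf.IsUniform X A P volume)
    (hYm : AEMeasurable Y P) (hY : HasTameDensity (P.map Y) K d) (hXY : IndepFun X Y P) :
    HasTameDensity (P.map (X + Y)) (A + K) (d + n) := by
  rw [hXY.map_add_eq_map_conv_map₀ (hX.aemeasurable hA.volume_ne_zero hA.volume_ne_top) hYm, hX]
  exact hY.cond_conv hA

theorem HasTameDensity.map_sum {ι : Type*} {A : ι → Set (EuclideanSpace ℝ (Fin n))}
    (hA : ∀ i, IsConvexBody (A i)) {X : ι → Ω → EuclideanSpace ℝ (Fin n)} (hX : iIndepFun X P)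
    (hU : ∀ i, pdf.IsUniform (X i) (A i) P volume) {s : Finset ι} (hs : s.Nonempty) :
    IsConvexBody (∑ i ∈ s, A i) ∧
      HasTameDensity (P.map (∑ i ∈ s, X i)) (∑ i ∈ s, A i) (n * (s.card - 1)) := by
  have hm : ∀ i, AEMeasurable (X i) P :=
    fun i => (hU i).aemeasurable (hA i).volume_ne_zero (hA i).volume_ne_top
  induction hs using Finset.Nonempty.cons_induction with
  | singleton i =>
    have h := HasTameDensity.cond (hA i)
    rw [← (hU i : P.map (X i) = _)] at h
    simpa using ⟨hA i, h⟩
  | cons i s hi hs ih =>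
    rw [Finset.sum_cons, Finset.sum_cons, Finset.card_cons]
    refine ⟨(hA i).add ih.1, ?_⟩
    have := ih.2.map_add (hA i) (hU i) (Finset.aemeasurable_sum s fun j _ => hm j)
      (hX.indepFun_finsetSum_of_notMem₀ hm hi).symm
    have hc := hs.card_pos
    convert this using 1
    obtain ⟨k, hk⟩ := Nat.exists_eq_add_of_lt hc
    rw [hk]
    simp [mul_add]

end

open Filter Topology

/-- If `t * a` is at most a function of `t` vanishing to second order at zero,
then `a` is nonpositive. -/
theorem nonpos_of_mul_le_of_hasDerivAt_zero {G : ℝ → ℝ} {a : ℝ} (hG : HasDerivAt G 0 0)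
    (hG0 : G 0 = 0) (h : ∀ t, 0 < t → t < 1 → t * a ≤ G t) : a ≤ 0 := by
  have h1 : Tendsto (fun t => t⁻¹ * G t) (𝓝[>] 0) (𝓝 0) := by
    have := (hasDerivAt_iff_tendsto_slope.1 hG).mono_left
      (nhdsWithin_mono 0 fun x (hx : 0 < x) => hx.ne')
    refine this.congr fun t => ?_
    simp [slope, hG0]
  refine ge_of_tendsto h1 ?_
  filter_upwards [Ioo_mem_nhdsGT (zero_lt_one' ℝ)] with t ht
  rw [le_inv_mul_iff₀ ht.1]
  exact h t ht.1 ht.2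

theorem hasDerivAt_log_one_sub_mul_zero (c : ℝ) :
    HasDerivAt (fun t : ℝ => Real.log (1 - c * t)) (-c) 0 := by
  have h : HasDerivAt (fun t : ℝ => 1 - c * t) (-c) 0 := by
    simpa using ((hasDerivAt_id (0 : ℝ)).const_mul c).const_sub 1
  simpa using h.log (by simp)

section

variable {α : Type*} [MeasurableSpace α] {μ : Measure α}

theorem ofReal_integral_le_lintegral_ofReal {ψ : α → ℝ} (hψ : Integrable ψ μ) :
    ENNReal.ofReal (∫ x, ψ x ∂μ) ≤ ∫⁻ x, ENNReal.ofReal (ψ x) ∂μ := by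
  rw [integral_eq_lintegral_pos_part_sub_lintegral_neg_part hψ]
  exact (ENNReal.ofReal_le_ofReal (sub_le_self _ ENNReal.toReal_nonneg)).trans
    ENNReal.ofReal_toReal_le

/-- A power integral of a probability density is bounded below through its entropy. -/
theorem ofReal_exp_integral_mul_log_le {φ : α → ℝ} (h0 : ∀ x, 0 ≤ φ x) (hφ : Integrable φ μ)
    (h1 : ∫ x, φ x ∂μ = 1) (hL : Integrable (fun x => φ x * Real.log (φ x)) μ) {s : ℝ}
    (hs : 0 < s) :
    ENNReal.ofReal (Real.exp (s * ∫ x, φ x * Real.log (φ x) ∂μ)) ≤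
      ∫⁻ x, ENNReal.ofReal (φ x) ^ (1 + s) ∂μ := by
  set I := ∫ x, φ x * Real.log (φ x) ∂μ with hI
  set ψ : α → ℝ := fun x => Real.exp (s * I) * (1 - s * I) * φ x +
    Real.exp (s * I) * s * (φ x * Real.log (φ x)) with hψ
  have hψi : Integrable ψ μ := (hφ.const_mul _).add (hL.const_mul _)
  have e : ∫ x, ψ x ∂μ = Real.exp (s * I) := by
    rw [hψ, integral_add (hφ.const_mul _) (hL.const_mul _), integral_const_mul,
      integral_const_mul, h1, ← hI]
    ring
  rw [← e]
  refine (ofReal_integral_le_lintegral_ofReal hψi).trans (lintegral_mono fun x => ?_)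
  dsimp only
  rw [ENNReal.ofReal_rpow_of_nonneg (h0 x) (by linarith)]
  refine ENNReal.ofReal_le_ofReal ?_
  rcases (h0 x).eq_or_lt with hx | hx
  · simp only [hψ, ← hx]
    simp [Real.zero_rpow (by linarith : 1 + s ≠ 0)]
  · rw [Real.rpow_add hx, Real.rpow_one, Real.rpow_def_of_pos hx]
    have h2 : s * Real.log (φ x) - s * I + 1 ≤ Real.exp (s * Real.log (φ x) - s * I) :=
      Real.add_one_le_exp _
    have h3 : Real.exp (Real.log (φ x) * s) =
        Real.exp (s * I) * Real.exp (s * Real.log (φ x) - s * I) := by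
      rw [← Real.exp_add]; ring_nf
    have h4 := mul_le_mul_of_nonneg_left h2 (mul_nonneg hx.le (Real.exp_pos (s * I)).le)
    rw [h3]
    simp only [hψ]
    linarith

/-- Among the probability densities supported in a set, the uniform one has maximal entropy. -/
theorem neg_integral_mul_log_le {φ : α → ℝ} {K : Set α} (hK : MeasurableSet K)
    (hK0 : μ K ≠ 0) (hKt : μ K ≠ ∞) (h0 : ∀ x, 0 ≤ φ x) (hφK : ∀ x, x ∉ K → φ x = 0)
    (hφ : Integrable φ μ) (h1 : ∫ x, φ x ∂μ = 1)
    (hL : Integrable (fun x => φ x * Real.log (φ x)) μ) :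
    - ∫ x, φ x * Real.log (φ x) ∂μ ≤ Real.log (μ.real K) := by
  have hV : 0 < μ.real K := ENNReal.toReal_pos hK0 hKt
  have hi : Integrable (K.indicator fun _ => (μ.real K)⁻¹) μ :=
    (integrable_indicator_iff hK).2 (integrableOn_const hKt)
  have h : ∫ x, -(φ x * Real.log (φ x)) ∂μ ≤
      ∫ x, ((Real.log (μ.real K) - 1) * φ x + K.indicator (fun _ => (μ.real K)⁻¹) x) ∂μ := by
    refine integral_mono hL.neg ((hφ.const_mul _).add hi) fun x => ?_
    dsimp only
    by_cases hx : x ∈ K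
    · rw [Set.indicator_of_mem hx]
      rcases (h0 x).eq_or_lt with hx0 | hx0
      · rw [← hx0]; simp [hV.le]
      · have h2 := Real.log_le_sub_one_of_pos (show 0 < (φ x * μ.real K)⁻¹ by positivity)
        rw [Real.log_inv, Real.log_mul hx0.ne' hV.ne'] at h2
        have h3 := mul_le_mul_of_nonneg_left h2 hx0.le
        have h4 : φ x * ((φ x * μ.real K)⁻¹ - 1) = (μ.real K)⁻¹ - φ x := by field_simp
        rw [h4] at h3
        linarith
    · simp [hφK x hx, hx]
  rw [integral_neg, integral_add (hφ.const_mul _) hi, integral_const_mul, h1,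
    integral_indicator hK, setIntegral_const, smul_eq_mul, mul_inv_cancel₀ hV.ne'] at h
  linarith

/-- A bounded density supported in a set of finite measure has finite entropy. -/
theorem integrable_mul_log_of_bounded {φ : α → ℝ} {K : Set α} (hKt : μ K ≠ ∞)
    (hφm : Measurable φ) (h0 : ∀ x, 0 ≤ φ x) {C : ℝ} (hC : ∀ x, φ x ≤ C)
    (hφK : ∀ x, x ∉ K → φ x = 0) : Integrable (fun x => φ x * Real.log (φ x)) μ := by
  obtain ⟨M, hM⟩ := (isCompact_Icc (a := (0 : ℝ)) (b := C)).exists_bound_of_continuousOn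
    Real.continuous_mul_log.continuousOn
  have : IntegrableOn (fun x => φ x * Real.log (φ x)) K μ :=
    Measure.integrableOn_of_bounded (M := M) hKt (by fun_prop)
      (ae_of_all _ fun x => hM _ ⟨h0 x, hC x⟩)
  refine (integrableOn_iff_integrable_of_support_subset fun x hx => ?_).1 this
  by_contra h
  simp [hφK x h] at hx

end

section

variable {n : ℕ}

theorem prekopaLeindler_bound {f : EuclideanSpace ℝ (Fin n) → ℝ≥0∞} (hf : Measurable f)
    {K : Set (EuclideanSpace ℝ (Fin n))} (hK : MeasurableSet K) {d m : ℕ} (hm : 1 ≤ m)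
    (hfg : ∀ ε : ℝ, 0 < ε → ε < 1 → ∀ x, ∀ y ∈ K,
      ENNReal.ofReal (1 - ε) ^ d * f x ≤ f ((1 - ε) • x + ε • y)) {t : ℝ} (ht0 : 0 < t)
    (ht1 : t < 1) :
    (ENNReal.ofReal ((((1 - t) / (1 - t / m)) ^ n)⁻¹) * ∫⁻ x, f x ^ (1 - t)⁻¹) ^ (1 - t) *
      ENNReal.ofReal (1 - t / m) ^ d *
      (ENNReal.ofReal (((m : ℝ) ^ n)⁻¹) * volume K) ^ t ≤ ∫⁻ x, f x := by
  have hm' : (1 : ℝ) ≤ m := by exact_mod_cast hm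
  have hε0 : 0 < t / m := by positivity
  have hε1 : t / m < 1 := (div_le_self ht0.le hm').trans_lt ht1
  have ht1' : 0 < 1 - t := by linarith
  have hε1' : 0 < 1 - t / m := by linarith
  set r := (1 - t) / (1 - t / m) with hr
  have hr0 : 0 < r := by positivity
  set c := ENNReal.ofReal (1 - t / m) ^ d with hc
  have key := prekopaLeindler_euclideanSpace n t ht0 ht1
    (fun x => c ^ (1 - t)⁻¹ * f (r • x + 0) ^ (1 - t)⁻¹)
    (fun y => K.indicator 1 ((m : ℝ) • y + 0)) f (by fun_prop)
    ((measurable_one.indicator hK).comp (by fun_prop)) hf fun x y => by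
      rw [add_zero, add_zero, ENNReal.mul_rpow_of_nonneg _ _ ht1'.le, ← ENNReal.rpow_mul,
        ← ENNReal.rpow_mul, inv_mul_cancel₀ ht1'.ne', ENNReal.rpow_one, ENNReal.rpow_one]
      by_cases hy : (m : ℝ) • y ∈ K
      · have h := hfg _ hε0 hε1 (r • x) _ hy
        rw [smul_smul, smul_smul, hr, mul_div_cancel₀ _ hε1'.ne',
          div_mul_cancel₀ _ (by positivity)] at h
        simpa [hy] using h
      · simp [hy, ENNReal.zero_rpow_of_pos ht0]
  rw [lintegral_const_mul _ (by fun_prop),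
    lintegral_comp_smul_add (fun x => f x ^ (1 - t)⁻¹) (by fun_prop) hr0 0,
    lintegral_comp_smul_add _ (measurable_one.indicator hK) (by positivity) 0,
    lintegral_indicator_one hK, ENNReal.mul_rpow_of_nonneg _ _ ht1'.le, ← ENNReal.rpow_mul,
    inv_mul_cancel₀ ht1'.ne', ENNReal.rpow_one, mul_comm c] at key
  exact key

theorem log_volume_sub_le {f : EuclideanSpace ℝ (Fin n) → ℝ≥0∞} (hf : Measurable f)
    (hft : ∀ x, f x ≠ ∞) (hf1 : ∫⁻ x, f x = 1)
    (hL : Integrable (fun x => (f x).toReal * Real.log (f x).toReal))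
    {K : Set (EuclideanSpace ℝ (Fin n))} (hK : MeasurableSet K) (hK0 : volume K ≠ 0)
    (hKt : volume K ≠ ∞) {m : ℕ} (hm : 1 ≤ m)
    (hfg : ∀ ε : ℝ, 0 < ε → ε < 1 → ∀ x, ∀ y ∈ K,
      ENNReal.ofReal (1 - ε) ^ (n * (m - 1)) * f x ≤ f ((1 - ε) • x + ε • y)) :
    Real.log (volume.real K) - n * Real.log m ≤ - ∫ x, (f x).toReal * Real.log (f x).toReal := by
  have hm' : (1 : ℝ) ≤ m := by exact_mod_cast hm
  have hm0 : (m : ℝ) ≠ 0 := by positivity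
  have hV : 0 < volume.real K := ENNReal.toReal_pos hK0 hKt
  set I := ∫ x, (f x).toReal * Real.log (f x).toReal with hI
  have hint : Integrable (fun x => (f x).toReal) := integrable_toReal_of_lintegral_ne_top
    hf.aemeasurable (by simp [hf1])
  have hint1 : ∫ x, (f x).toReal = 1 := by
    rw [integral_toReal hf.aemeasurable (ae_of_all _ fun x => (hft x).lt_top), hf1]; simp
  have key : ∀ t, 0 < t → t < 1 →
      t * (Real.log (volume.real K) - n * Real.log m + I) ≤
        n * ((1 - t) * (Real.log (1 - t) - Real.log (1 - (m : ℝ)⁻¹ * t))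
          - (m - 1) * Real.log (1 - (m : ℝ)⁻¹ * t)) := by
    intro t ht0 ht1
    have hε1 : t / m < 1 := (div_le_self ht0.le hm').trans_lt ht1
    have ht1' : 0 < 1 - t := by linarith
    have hε1' : 0 < 1 - t / m := by linarith
    have h := prekopaLeindler_bound hf hK hm hfg ht0 ht1
    have hJ := ofReal_exp_integral_mul_log_le (fun x => ENNReal.toReal_nonneg) hint hint1 hL
      (s := t / (1 - t)) (by positivity)
    have hq : 1 + t / (1 - t) = (1 - t)⁻¹ := by field_simp; ring
    simp only [ENNReal.ofReal_toReal (hft _), hq, ← hI] at hJ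
    have h' := le_trans (mul_le_mul_left (mul_le_mul_left (ENNReal.rpow_le_rpow
      (mul_le_mul_right hJ _) ht1'.le) _) _) h
    rw [hf1, ← ENNReal.ofReal_toReal hKt, ← measureReal_def, ← ENNReal.ofReal_mul (by positivity),
      ← ENNReal.ofReal_mul (by positivity), ENNReal.ofReal_rpow_of_pos (by positivity),
      ENNReal.ofReal_rpow_of_pos (by positivity), ← ENNReal.ofReal_pow hε1'.le,
      ← ENNReal.ofReal_mul (by positivity), ← ENNReal.ofReal_mul (by positivity),
      ENNReal.ofReal_le_one] at h'
    have hlog := Real.log_nonpos (by positivity) h'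
    rw [Real.log_mul (by positivity) (by positivity), Real.log_mul (by positivity) (by positivity),
      Real.log_rpow (by positivity), Real.log_rpow (by positivity), Real.log_pow,
      Real.log_mul (by positivity) (by positivity), Real.log_mul (by positivity) (by positivity),
      Real.log_exp, Real.log_inv, Real.log_inv, Real.log_pow, Real.log_pow,
      Real.log_div ht1'.ne' hε1'.ne'] at hlog
    have e1 : (1 - t) * (t / (1 - t) * I) = t * I := by field_simp
    rw [mul_add, e1] at hlog
    push_cast [Nat.cast_sub hm] at hlog
    rw [inv_mul_eq_div]
    linarith
  have hd : HasDerivAt (fun t : ℝ =>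
      n * ((1 - t) * (Real.log (1 - t) - Real.log (1 - (m : ℝ)⁻¹ * t))
          - (m - 1) * Real.log (1 - (m : ℝ)⁻¹ * t))) 0 0 := by
    have h1 := hasDerivAt_log_one_sub_mul_zero 1
    have h2 := hasDerivAt_log_one_sub_mul_zero (m : ℝ)⁻¹
    simp only [one_mul] at h1
    have h3 : HasDerivAt (fun t : ℝ => 1 - t) (-1) 0 := by
      simpa using (hasDerivAt_id (0 : ℝ)).const_sub 1
    refine (((h3.mul (h1.sub h2)).sub (h2.const_mul ((m : ℝ) - 1))).const_mul
      (n : ℝ)).congr_deriv ?_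
    simp
    right
    field_simp
    ring
  have := nonpos_of_mul_le_of_hasDerivAt_zero hd (by simp) key
  linarith

end

section

variable {Ω : Type*} [MeasurableSpace Ω] {P : Measure Ω} {n : ℕ}

theorem HasTameDensity.entropy_bounds [IsProbabilityMeasure P] {X : Ω → EuclideanSpace ℝ (Fin n)} (hX : AEMeasurable X P)
    {K : Set (EuclideanSpace ℝ (Fin n))} (hK : IsConvexBody K) {m : ℕ} (hm : 1 ≤ m)
    (h : HasTameDensity (P.map X) K (n * (m - 1))) :
    HasEntropy X P ∧ Real.log (volume.real K) - n * Real.log m ≤ entropy X P ∧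
      entropy X P ≤ Real.log (volume.real K) := by
  obtain ⟨f, hf, hXf, ⟨C, hC, hfC⟩, hf0, hfg⟩ := h
  have hpdf : HasPDF X P volume := hasPDF_of_map_eq_withDensity hX f hf.aemeasurable hXf
  have hft : ∀ x, f x ≠ ∞ := fun x => ((hfC x).trans_lt hC.lt_top).ne
  have hf1 : ∫⁻ x, f x = 1 := by
    have := Measure.isProbabilityMeasure_map hX
    rw [← setLIntegral_univ, ← withDensity_apply _ MeasurableSet.univ, ← hXf, measure_univ]
  have hae : pdf X P volume =ᵐ[volume] f :=
    (pdf.eq_of_map_eq_withDensity f hf.aemeasurable).1 hXf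
  have hae' : (fun x => density X P x * Real.log (density X P x)) =ᵐ[volume]
      fun x => (f x).toReal * Real.log (f x).toReal := by
    filter_upwards [hae] with x hx
    simp only [density, hx]
  have hL : Integrable (fun x => (f x).toReal * Real.log (f x).toReal) :=
    integrable_mul_log_of_bounded hK.volume_ne_top hf.ennreal_toReal
      (fun x => ENNReal.toReal_nonneg) (fun x => ENNReal.toReal_mono hC (hfC x))
      fun x hx => by simp [hf0 x hx]
  refine ⟨⟨hpdf, hL.congr hae'.symm⟩, ?_⟩
  rw [entropy, integral_congr_ae hae']
  refine ⟨log_volume_sub_le hf hft hf1 hL hK.isCompact.measurableSet hK.volume_ne_zero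
    hK.volume_ne_top hm hfg, ?_⟩
  refine neg_integral_mul_log_le hK.isCompact.measurableSet hK.volume_ne_zero hK.volume_ne_top
    (fun x => ENNReal.toReal_nonneg) (fun x hx => by simp [hf0 x hx])
    (integrable_toReal_of_lintegral_ne_top hf.aemeasurable (by simp [hf1])) ?_ hL
  rw [integral_toReal hf.aemeasurable (ae_of_all _ fun x => (hft x).lt_top), hf1]; simp

/-- Bounds on the entropy of a random vector translate to bounds on its entropy power. -/
theorem entropyPower_bounds (hn : 1 ≤ n) {X : Ω → EuclideanSpace ℝ (Fin n)} {V : ℝ} (hV : 0 < V)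
    (h1 : Real.log V - n * Real.log 2 ≤ entropy X P) (h2 : entropy X P ≤ Real.log V) :
    (1 / 4 : ℝ) * V ^ ((2 : ℝ) / (n : ℝ)) ≤ entropyPower X P ∧
      entropyPower X P ≤ V ^ ((2 : ℝ) / (n : ℝ)) := by
  have hn' : (0 : ℝ) < n := by exact_mod_cast hn
  rw [entropyPower, Real.rpow_def_of_pos hV]
  constructor
  · have e : (1 / 4 : ℝ) = Real.exp (-(2 * Real.log 2)) := by
      rw [Real.exp_neg, two_mul, Real.exp_add, Real.exp_log two_pos]; norm_num
    rw [e, ← Real.exp_add, Real.exp_le_exp, le_div_iff₀ hn']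
    have : (-(2 * Real.log 2) + Real.log V * (2 / n)) * n =
        2 * (Real.log V - n * Real.log 2) := by field_simp; ring
    rw [this]
    linarith
  · rw [Real.exp_le_exp, div_le_iff₀ hn']
    have : Real.log V * (2 / n) * n = 2 * Real.log V := by field_simp
    rw [this]
    linarith

end

end VolEnt

theorem proposition3p4 {Ω : Type*} [MeasurableSpace Ω] (P : Measure Ω) [IsProbabilityMeasure P]
    (n : ℕ) (hn : 1 ≤ n) :
    (∀ (m : ℕ), 1 ≤ m →
      ∀ (A : Fin m → Set (EuclideanSpace ℝ (Fin n))) (X : Fin m → Ω → EuclideanSpace ℝ (Fin n)),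
        (∀ i, VolEnt.IsConvexBody (A i)) →
        iIndepFun X P →
        (∀ i, pdf.IsUniform (X i) (A i) P volume) →
        VolEnt.HasEntropy (fun ω => ∑ i, X i ω) P ∧
        Real.log (volume.real (∑ i, A i)) - n * Real.log m
          ≤ VolEnt.entropy (fun ω => ∑ i, X i ω) P ∧
        VolEnt.entropy (fun ω => ∑ i, X i ω) P ≤ Real.log (volume.real (∑ i, A i))) ∧
    (∀ (A B : Set (EuclideanSpace ℝ (Fin n))) (X Y : Ω → EuclideanSpace ℝ (Fin n)),
        VolEnt.IsConvexBody A → VolEnt.IsConvexBody B →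
        IndepFun X Y P →
        pdf.IsUniform X A P volume → pdf.IsUniform Y B P volume →
        VolEnt.HasEntropy (fun ω => X ω + Y ω) P ∧
        (1 / 4 : ℝ) * volume.real (A + B) ^ ((2 : ℝ) / (n : ℝ))
          ≤ VolEnt.entropyPower (fun ω => X ω + Y ω) P ∧
        VolEnt.entropyPower (fun ω => X ω + Y ω) P
          ≤ volume.real (A + B) ^ ((2 : ℝ) / (n : ℝ))) := by
  refine ⟨fun m hm A X hA hX hU => ?_, fun A B X Y hA hB hXY hX hY => ?_⟩
  · have : Nonempty (Fin m) := ⟨⟨0, hm⟩⟩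
    obtain ⟨hK, h⟩ := VolEnt.HasTameDensity.map_sum hA hX hU Finset.univ_nonempty
    have hXm : AEMeasurable (∑ i, X i) P := Finset.aemeasurable_sum _ fun i _ =>
      (hU i).aemeasurable (hA i).volume_ne_zero (hA i).volume_ne_top
    rw [Finset.card_univ, Fintype.card_fin] at h
    have e : (fun ω => ∑ i, X i ω) = ∑ i, X i := by ext; simp
    rw [e]
    exact h.entropy_bounds hXm hK hm
  · have hXm := hX.aemeasurable hA.volume_ne_zero hA.volume_ne_top
    have hYm := hY.aemeasurable hB.volume_ne_zero hB.volume_ne_top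
    have hK := hA.add hB
    have hB0 := VolEnt.HasTameDensity.cond hB
    rw [← (hY : P.map Y = _)] at hB0
    have h := hB0.map_add hA hX hYm hXY
    rw [show 0 + n = n * (2 - 1) by simp] at h
    obtain ⟨h1, h2, h3⟩ := h.entropy_bounds (hXm.add hYm) hK one_le_two
    exact ⟨h1, VolEnt.entropyPower_bounds hn
      (ENNReal.toReal_pos hK.volume_ne_zero hK.volume_ne_top) h2 h3⟩
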